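/- Let $\tau$ be an infinite cardinal, let $\{X_\beta : \beta\in B\}$ be a family of compact Hausdorff spaces with more than one point each, and let $p=(p_\beta)_{\beta\in B}\in\prod_{\beta\in B}X_\beta$. The $\Sigma_\tau$-product of the family about $p$ is the subspace $$\Sigma_\tau(p)=\Big\{x\in\prod_{\beta\in B}X_\beta : |\{\beta\in B: x_\beta\neq p_\beta\}|\le\tau\Big\}$$ of the Tychonoff product. (1) If $|B|\ge\tau^+$ and every $X_\beta$ has a dense subset of cardinality at most $\tau$, then $\Sigma_\tau(p)$ is not subcompact, i.e. there is no continuous bijection (condensation) from $\Sigma_\tau(p)$ onto a compact Hausdorff space. (2) In particular, if $B$ is uncountable and every $X_\beta$ is metrizable, then the $\Sigma$-product $\Sigma_{\aleph_0}(p)$ is not subcompact. -/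

import Mathlib

open Cardinal

universe u v

/-- The density of a topological space: the least cardinality of a dense subset. -/
noncomputable def density (X : Type u) [TopologicalSpace X] : Cardinal.{u} :=
  sInf {c : Cardinal.{u} | ∃ s : Set X, Dense s ∧ #s = c}

/-- A condensation: a continuous bijection. -/
def IsCondensation {X : Type u} {Y : Type v} [TopologicalSpace X] [TopologicalSpace Y]
    (f : X → Y) : Prop :=
  Continuous f ∧ Function.Bijective f

/-- A space is subcompact if it admits a condensation onto a compactum (a compact Hausdorff
space). Since a condensation is a bijection, taking the compactum in the universe of `X` is no
restriction. -/
def Subcompact (X : Type u) [TopologicalSpace X] : Prop :=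
  ∃ (K : Type u) (_ : TopologicalSpace K) (_ : CompactSpace K) (_ : T2Space K) (f : X → K),
    IsCondensation f

/-- The support of a point `x` of a product with respect to the base point `p`. -/
def supp {B : Type u} {X : B → Type v} (p x : ∀ b, X b) : Set B :=
  {b | x b ≠ p b}

/-- The `Σ_τ`-product about `p`, as a subset of the Cartesian product: the points whose support
has cardinality at most `τ`. Its coercion to a type carries the subspace topology of the
Tychonoff product. -/
def sigmaProduct {B : Type u} {X : B → Type v} (τ : Cardinal.{u}) (p : ∀ b, X b) :
    Set (∀ b, X b) :=
  {x | #(supp p x) ≤ τ}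

open Filter Topology Set

/-! Suppose `f` condenses the `Σ_τ`-product onto a compactum `K`. Fix `τ⁺ ≤ 2 ^ τ` coordinates `B'`;
by Hewitt–Marczewski–Pondiczery (`denseRange_codedPoint`) the points supported in `B'` lie in the
closure of at most `τ` points `d δ` of the full product. Compactness of `K` gives `f` a cluster
point `k δ` at each `d δ`. The preimages of the `k δ` have supports with union `S` of size at most
`τ`, and the points supported in `S` form a compact set, whose image is closed and contains every `k
δ`. By `mem_closure_range_of_mapClusterPt` and injectivity, every point of the `Σ_τ`-product
supported in `B'` is then supported in `S`, which fails at any coordinate of `B' \ S`. -/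

section Density

open Classical in
/-- Given subsets `ι i` of a set `T` and maps `e i : T → X i`, the point of the product coded by a
finite set `δ.1` and a finite relation `δ.2`: its coordinate at `i` is `e i t` for some `t` which
`δ.2` relates to the trace of `ι i` on `δ.1`. -/
noncomputable def codedPoint {I T : Type*} {X : I → Type*} (ι : I → Set T) (e : ∀ i, T → X i)
    (p : ∀ i, X i) (δ : Finset T × Finset (Finset T × T)) (i : I) : X i :=
  if h : ∃ t, (δ.1.filter (· ∈ ι i), t) ∈ δ.2 then e i h.choose else p i

open Classical in
/-- Finitely many distinct sets have distinct traces on a suitable finite set. -/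
theorem exists_finset_injOn_filter {I T : Type*} {ι : I → Set T} (hι : Function.Injective ι)
    (J : Finset I) : ∃ s : Finset T, Set.InjOn (fun i => s.filter (· ∈ ι i)) (J : Set I) := by
  have h : ∀ i j, i ≠ j → ∃ t, ¬ (t ∈ ι i ↔ t ∈ ι j) := fun i j hij => by
    by_contra! hc
    exact hij (hι (Set.ext hc))
  choose t ht using h
  refine ⟨J.offDiag.attach.image
    fun q => t q.1.1 q.1.2 (Finset.mem_offDiag.1 q.2).2.2, fun i hi j hj hij => ?_⟩
  by_contra hne
  refine ht i j hne ?_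
  have hm : t i j hne ∈ J.offDiag.attach.image
      fun q => t q.1.1 q.1.2 (Finset.mem_offDiag.1 q.2).2.2 :=
    Finset.mem_image.2 ⟨⟨(i, j), Finset.mem_offDiag.2 ⟨hi, hj, hne⟩⟩, Finset.mem_attach _ _, rfl⟩
  simpa [hm] using Finset.ext_iff.1 hij (t i j hne)

/-- The Hewitt–Marczewski–Pondiczery theorem: a product of at most `2 ^ #T` spaces, each with a
dense subset indexed by `T`, has a dense subset indexed by the finite codes over `T`. -/
theorem denseRange_codedPoint {I T : Type*} {X : I → Type*} [∀ i, TopologicalSpace (X i)]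
    {ι : I → Set T} (hι : Function.Injective ι) {e : ∀ i, T → X i} (he : ∀ i, DenseRange (e i))
    (p : ∀ i, X i) : DenseRange (codedPoint ι e p) := by
  classical
  refine dense_iff_inter_open.2 fun U hU ⟨x, hx⟩ => ?_
  obtain ⟨J, u, hu, hJ⟩ := isOpen_pi_iff.1 hU x hx
  have ht : ∀ i, ∃ t, i ∈ J → e i t ∈ u i := fun i => by
    by_cases hi : i ∈ J
    · obtain ⟨t, h⟩ := (he i).exists_mem_open (hu i hi).1 ⟨_, (hu i hi).2⟩
      exact ⟨t, fun _ => h⟩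
    · obtain ⟨t, -⟩ := (he i).exists_mem_open isOpen_univ ⟨p i, trivial⟩
      exact ⟨t, fun h => absurd h hi⟩
  choose t ht using ht
  obtain ⟨s, hs⟩ := exists_finset_injOn_filter hι J
  refine ⟨_, hJ fun i hi => ?_, ⟨(s, J.image fun i => (s.filter (· ∈ ι i), t i)), rfl⟩⟩
  have h : ∃ t', (s.filter (· ∈ ι i), t') ∈ J.image fun i => (s.filter (· ∈ ι i), t i) :=
    ⟨t i, Finset.mem_image_of_mem _ hi⟩
  -- The chosen value comes from some `j ∈ J` with the same trace as `i`; as traces on `s` separate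
  -- `J`, it is the value at `i`.
  obtain ⟨j, hj, hji⟩ := Finset.mem_image.1 h.choose_spec
  obtain ⟨hjs, hjt⟩ := Prod.mk.injEq _ _ _ _ ▸ hji
  obtain rfl : j = i := hs hj hi hjs
  have hv : codedPoint ι e p (s, J.image fun i => (s.filter (· ∈ ι i), t i)) j = e j h.choose := by
    unfold codedPoint
    exact dif_pos h
  rw [hv, ← hjt]
  exact ht j hj

/-- A nonempty space of density at most `#T` has a dense subset indexed by `T`. -/
theorem exists_denseRange_of_density_le {T : Type u} {X : Type v} [TopologicalSpace X] [Nonempty X]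
    (h : Cardinal.lift.{u} (density X) ≤ Cardinal.lift.{v} #T) : ∃ e : T → X, DenseRange e := by
  obtain ⟨s, hs, hsc⟩ : density X ∈ {c : Cardinal.{v} | ∃ s : Set X, Dense s ∧ #s = c} :=
    csInf_mem ⟨_, univ, dense_univ, rfl⟩
  rw [← hsc, Cardinal.lift_mk_le'] at h
  obtain ⟨g⟩ := h
  have : Nonempty s := hs.nonempty.to_subtype
  refine ⟨fun t => (Function.invFun g t : s), hs.mono fun x hx => ?_⟩
  exact ⟨g ⟨x, hx⟩, by simp [Function.leftInverse_invFun g.injective ⟨x, hx⟩]⟩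

theorem density_le_aleph0 (X : Type v) [TopologicalSpace X] [TopologicalSpace.SeparableSpace X] :
    density X ≤ ℵ₀ := by
  obtain ⟨s, hs, hd⟩ := TopologicalSpace.exists_countable_dense X
  have h : density X ≤ #s := csInf_le' ⟨s, hd, rfl⟩
  exact h.trans hs.le_aleph0

theorem mk_codes_le (T : Type u) [Infinite T] : #(Finset T × Finset (Finset T × T)) ≤ #T := by
  simp [Cardinal.mk_finset_of_infinite, Cardinal.mul_eq_self (Cardinal.aleph0_le_mk T)]

end Density

section SigmaProduct

variable {B : Type u} {X : B → Type v} {p : ∀ b, X b} {τ : Cardinal.{u}}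

theorem supp_update_subset [DecidableEq B] (b : B) (a : X b) :
    supp p (Function.update p b a) ⊆ {b} := fun c hc => by
  by_contra h
  exact hc (Function.update_of_ne h _ _)

/-- The points supported in a set of cardinality at most `τ` belong to the `Σ_τ`-product. -/
theorem mem_sigmaProduct_of_supp_subset {S : Set B} (hS : #S ≤ τ) {x : ∀ b, X b}
    (hx : supp p x ⊆ S) : x ∈ sigmaProduct τ p :=
  (Cardinal.mk_le_mk_of_subset hx).trans hS

variable [∀ b, TopologicalSpace (X b)]

theorem dense_sigmaProduct (hτ : ℵ₀ ≤ τ) : Dense (sigmaProduct τ p) := by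
  classical
  refine dense_iff_inter_open.2 fun U hU ⟨x, hx⟩ => ?_
  obtain ⟨J, u, hu, hJ⟩ := isOpen_pi_iff.1 hU x hx
  refine ⟨fun b => if b ∈ J then x b else p b, hJ fun b hb => ?_, ?_⟩
  · simpa [Finset.mem_coe.1 hb] using (hu b hb).2
  · refine mem_sigmaProduct_of_supp_subset (S := (J : Set B))
      ((Cardinal.lt_aleph0_of_finite _).le.trans hτ) fun b hb => ?_
    by_contra h
    exact hb (if_neg h)

theorem isClosed_setOf_supp_subset [∀ b, T2Space (X b)] (S : Set B) :
    IsClosed {x : ∀ b, X b | supp p x ⊆ S} := by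
  have : {x : ∀ b, X b | supp p x ⊆ S} = ⋂ b ∈ Sᶜ, {x | x b = p b} := by
    ext x
    simp only [mem_ofPred_eq, mem_iInter, mem_compl_iff]
    exact forall_congr' fun b => not_imp_comm
  rw [this]
  exact isClosed_biInter fun b _ => isClosed_eq (continuous_apply b) continuous_const

/-- In a `Σ_τ`-product of compacta, the points with support in a fixed set of cardinality at most
`τ` form a compact set. -/
theorem isCompact_sigmaProduct_supp_subset [∀ b, T2Space (X b)] [∀ b, CompactSpace (X b)]
    {S : Set B} (hS : #S ≤ τ) : IsCompact {x : sigmaProduct τ p | supp p x.1 ⊆ S} := by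
  rw [Subtype.isCompact_iff]
  convert (isClosed_setOf_supp_subset (p := p) S).isCompact using 1
  ext x
  simp only [mem_image, mem_ofPred_eq]
  exact ⟨fun ⟨y, hy, hyx⟩ => hyx ▸ hy,
    fun hx => ⟨⟨x, mem_sigmaProduct_of_supp_subset hS hx⟩, hx, rfl⟩⟩

end SigmaProduct

/-- Let `f` be a continuous map from a dense subspace `A` of `Y` to a compactum `K`. Cluster points
of `f` at the points `d δ` accumulate at `f x` as soon as the `d δ` accumulate at `x`. -/
theorem mem_closure_range_of_mapClusterPt {Y K D : Type*} [TopologicalSpace Y] [TopologicalSpace K]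
    [RegularSpace K] {A : Set Y} {f : A → K} (hf : Continuous f) {d : D → Y} {k : D → K}
    (hk : ∀ δ, MapClusterPt (k δ) (comap Subtype.val (𝓝 (d δ))) f) {x : A}
    (hx : (x : Y) ∈ closure (range d)) : f x ∈ closure (range k) := by
  refine (mem_closure_iff_nhds_basis (closed_nhds_basis (f x))).2 fun W ⟨hW, hWc⟩ => ?_
  have hfW : f ⁻¹' W ∈ 𝓝 x := hf.continuousAt hW
  rw [nhds_subtype_eq_comap] at hfW
  obtain ⟨V, hV, hVW⟩ := hfW
  obtain ⟨U, hUV, hU, hxU⟩ := mem_nhds_iff.1 hV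
  obtain ⟨_, hdU, δ, rfl⟩ := mem_closure_iff.1 hx U hU hxU
  refine ⟨k δ, mem_range_self δ, ?_⟩
  have hfV : f ⁻¹' W ∈ comap Subtype.val (𝓝 (d δ)) :=
    ⟨V, mem_of_superset (hU.mem_nhds hdU) hUV, hVW⟩
  exact hWc.closure_eq ▸ mem_closure_iff_clusterPt.2
    (ClusterPt.mono (hk δ) (le_principal_iff.2 hfV))

theorem not_subcompact_sigmaProduct {B : Type u} {X : B → Type v} [∀ b, TopologicalSpace (X b)]
    [∀ b, CompactSpace (X b)] [∀ b, T2Space (X b)] [∀ b, Nontrivial (X b)] (p : ∀ b, X b)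
    {τ : Cardinal.{u}} (hτ : ℵ₀ ≤ τ) (hB : Order.succ τ ≤ #B)
    (hd : ∀ b, Cardinal.lift.{u} (density (X b)) ≤ Cardinal.lift.{v} τ) :
    ¬ Subcompact (sigmaProduct τ p) := by
  classical
  rintro ⟨K, _, _, _, f, hf, hinj, hsurj⟩
  obtain ⟨T, rfl⟩ : ∃ T : Type u, #T = τ := ⟨τ.out, τ.mk_out⟩
  have : Infinite T := Cardinal.aleph0_le_mk_iff.1 hτ
  -- Exactly `τ⁺` coordinates: few enough to inject into `Set T`, too many to fit inside `S`.
  obtain ⟨B', hB'⟩ := Cardinal.le_mk_iff_exists_set.1 hB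
  obtain ⟨ι⟩ : Nonempty (B' ↪ Set T) := by
    rw [← Cardinal.le_def, hB', Cardinal.mk_set]
    exact Order.succ_le_of_lt (Cardinal.cantor _)
  choose e he using fun b => exists_denseRange_of_density_le (hd b)
  let E : (∀ b : B', X b) → ∀ b, X b := fun y b => if h : b ∈ B' then y ⟨b, h⟩ else p b
  have hE : Continuous E := continuous_pi fun b => by
    by_cases h : b ∈ B'
    · simpa only [E, dif_pos h] using continuous_apply _
    · simpa only [E, dif_neg h] using continuous_const
  let d := fun δ => E (codedPoint ι (fun b : B' => e b) (fun b => p b) δ)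
  have hdc : ∀ x, supp p x ⊆ B' → x ∈ closure (range d) := fun x hx => by
    have hxE : x = E fun b => x b := funext fun b => by
      by_cases h : b ∈ B'
      · simp only [E, dif_pos h]
      · simp only [E, dif_neg h]
        exact not_not.1 fun hb => h (hx hb)
    have := hE.range_subset_closure_image_dense
      (denseRange_codedPoint ι.injective (fun b : B' => he b) fun b => p b)
    rw [← range_comp] at this
    rw [hxE]
    exact this (mem_range_self (f := E) fun b : B' => x b)
  -- `d δ` may lie outside the `Σ_τ`-product, so a cluster point along the trace of its
  -- neighbourhoods replaces the value `f (d δ)`.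
  have hk : ∀ δ, ∃ k, MapClusterPt k (comap Subtype.val (𝓝 (d δ))) f := fun δ => by
    have : (comap (Subtype.val : sigmaProduct #T p → _) (𝓝 (d δ))).NeBot :=
      mem_closure_iff_comap_neBot.1 (dense_sigmaProduct hτ _)
    exact exists_clusterPt_of_compactSpace _
  choose k hk using hk
  choose y hy using fun δ => hsurj (k δ)
  let S := ⋃ δ, supp p (y δ).1
  have hS : #S ≤ #T := by
    refine (Cardinal.mk_iUnion_le _).trans ((mul_le_mul' (mk_codes_le T)
      (ciSup_le' fun δ => (y δ).2)).trans (Cardinal.mul_eq_self hτ).le)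
  obtain ⟨b, hb, hbS⟩ : ∃ b ∈ B', b ∉ S := by
    by_contra! h
    exact (Order.lt_succ #T).not_ge (hB' ▸ (Cardinal.mk_le_mk_of_subset h).trans hS)
  obtain ⟨a, ha⟩ := exists_ne (p b)
  have hsub := supp_update_subset (p := p) b a
  have hC := ((isCompact_sigmaProduct_supp_subset (p := p) hS).image hf).isClosed
  have hkC : closure (range k) ⊆ _ := hC.closure_subset_iff.2 <| by
    rintro _ ⟨δ, rfl⟩
    exact ⟨y δ, subset_iUnion (fun δ => supp p (y δ).1) δ, hy δ⟩
  let x : sigmaProduct #T p := ⟨Function.update p b a,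
    mem_sigmaProduct_of_supp_subset (by simpa using Cardinal.one_le_aleph0.trans hτ) hsub⟩
  obtain ⟨z, hz, hzx⟩ := hkC (mem_closure_range_of_mapClusterPt hf hk (x := x)
    (hdc _ (hsub.trans (singleton_subset_iff.2 hb))))
  obtain rfl := hinj hzx
  exact hbS (hz (show Function.update p b a b ≠ p b by simpa using ha))

theorem proposition2p8 {B : Type u} {X : B → Type v} [∀ b, TopologicalSpace (X b)]
    [∀ b, CompactSpace (X b)] [∀ b, T2Space (X b)] [∀ b, Nontrivial (X b)] (p : ∀ b, X b) :
    (∀ τ : Cardinal.{u}, ℵ₀ ≤ τ → Order.succ τ ≤ #B →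
      (∀ b, Cardinal.lift.{u} (density (X b)) ≤ Cardinal.lift.{v} τ) →
      ¬ Subcompact (sigmaProduct τ p)) ∧
    (Uncountable B → (∀ b, TopologicalSpace.MetrizableSpace (X b)) →
      ¬ Subcompact (sigmaProduct ℵ₀ p)) := by
  refine ⟨fun τ hτ hB hd => not_subcompact_sigmaProduct p hτ hB hd, fun hB hm => ?_⟩
  refine not_subcompact_sigmaProduct p le_rfl
    (Order.succ_le_of_lt (Cardinal.aleph0_lt_mk_iff.2 hB)) fun b => ?_
  let := TopologicalSpace.metrizableSpaceMetric (X b)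
  simpa using density_le_aleph0 (X b)
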